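/- Consider the nonlinear system $\dot x = f(x) + g(x)u$, $x\in\mathbb{R}^n$, $u\in\mathbb{R}^m$, where $f$ and $g$ are Lipschitz on a compact set containing the origin in its interior and $f(0)=0$, and let $(A,B)$ be its linearization at the origin, i.e. $A = Df(0)$, $B = g(0)$. Let $Q=Q^T\ge 0$ and $R=R^T>0$ be such that $(Q^{1/2},A)$ is detectable, and let $K_0\in\mathbb{R}^{m\times n}$ be stabilizing, i.e. $A-BK_0$ is Hurwitz (so that $(A,B)$ is stabilizable). Put $\underline n = n(n+1)/2$, and for $x,y\in\mathbb{R}^n$ and $P\in\mathbb{R}^{n\times n}$ let $\mathcal B(x,y)\in\mathbb{R}^{\underline n}$ and $v(P)\in\mathbb{R}^{\underline n}$ be the vectors with entries, indexed by $1\le a\le b\le n$, $$\mathcal B(x,y)_{ab}=\tfrac12(x_ay_b+x_by_a),\qquad v(P)_{aa}=P_{aa},\quad v(P)_{ab}=2P_{ab}\ (a<b).$$ Let $W$ be the matrix with $\mathcal B(x,y)=W(x\otimes y)$ for all $x,y$, and $W_r^{-1}$ its right inverse with $x\otimes x=W_r^{-1}\mathcal B(x,x)$ for all $x$. Let $t_0<t_1<\dots<t_l$,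 and let $x$ be a solution of the system on $[t_0,t_l]$ under $u=-K_0x+d$, where $d$ is an exploration signal, such that $f(x)$ and $g(x)u$ are integrable on $[t_0,t_l]$. Put $w=f(x)-Ax$. Let $\delta_{xx}\in\mathbb{R}^{l\times\underline n}$ have rows $\mathcal B(x(t_{k+1})+x(t_k),\,x(t_{k+1})-x(t_k))^T$ and let $I_{\mathcal B(x,y)}\in\mathbb{R}^{l\times\underline n}$ have rows $\int_{t_k}^{t_{k+1}}\mathcal B(x,y)^T\,d\tau$, $k=0,\dots,l-1$. *EIRL algorithm:* for $i=0,1,\dots$, let $P_i=P_i^T$ be such that $v(P_i)$ is a least-squares solution of $\Theta_i v(P_i)=\Xi_i$, where $$\Theta_i=\delta_{xx}-2\big[I_{\mathcal B(x,x)}W_i^T+I_{\mathcal B(x,gu)}+I_{\mathcal B(x,w)}\big],\quad W_i=W(I_n\otimes BK_i)W_r^{-1},\quad \Xi_i=-I_{\mathcal B(x,x)}\,v(Q+K_i^TRK_i),$$ and put $K_{i+1}=R^{-1}B^TP_i$. *Kleinman's algorithm:* for $i=0,1,\dots$, let $P_i=P_i^T\ge 0$ solve $(A-BK_i)^TP_i+P_i(A-BK_i)+K_i^TRK_i+Q=0$,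 and put $K_{i+1}=R^{-1}B^TP_i$. Suppose that the sample instants are such that $I_{\mathcal B(x,x)}$ has full column rank $\underline n$. Then, started at $K_0$, both algorithms produce uniquely determined infinite sequences $\{P_i\}_{i\ge0}$, $\{K_i\}_{i\ge1}$, and these are identical for the two algorithms. Moreover: 1. $A-BK_i$ is Hurwitz for all $i\ge0$. 2. The Riccati equation $A^TP+PA-PBR^{-1}B^TP+Q=0$ has exactly one positive semidefinite solution $P^*$, and $P^*\le P_{i+1}\le P_i$ for all $i\ge0$. 3. $\lim_{i\to\infty}P_i=P^*$ and $\lim_{i\to\infty}K_i=K^*=R^{-1}B^TP^*$. If $(Q^{1/2},A)$ is observable, then $P^*$ and all $P_i$ are positive definite. -/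

import Mathlib

open Matrix MeasureTheory Filter Topology
open scoped Kronecker MatrixOrder

noncomputable section

namespace EIRL

/-- A real square matrix is Hurwitz if all its complex eigenvalues have negative real part. -/
def IsHurwitz {n : ℕ} (A : Matrix (Fin n) (Fin n) ℝ) : Prop :=
  ∀ z ∈ spectrum ℂ (A.map (algebraMap ℝ ℂ)), z.re < 0

/-- The pair `(C, A)` is detectable: some output injection makes `A - L C` Hurwitz. -/
def IsDetectable {n q : ℕ} (C : Matrix (Fin q) (Fin n) ℝ) (A : Matrix (Fin n) (Fin n) ℝ) : Prop :=
  ∃ L : Matrix (Fin n) (Fin q) ℝ, IsHurwitz (A - L * C)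

/-- The pair `(C, A)` is observable: its unobservable subspace `⋂ₖ ker (C Aᵏ)` is trivial. -/
def IsObservable {n q : ℕ} (C : Matrix (Fin q) (Fin n) ℝ) (A : Matrix (Fin n) (Fin n) ℝ) : Prop :=
  ∀ z : Fin n → ℝ, (∀ k : ℕ, (C * A ^ k) *ᵥ z = 0) → z = 0

/-- `P` is a symmetric positive semidefinite solution of the control algebraic Riccati equation. -/
def SolvesCARE {n m : ℕ} (A : Matrix (Fin n) (Fin n) ℝ) (B : Matrix (Fin n) (Fin m) ℝ)
    (Q : Matrix (Fin n) (Fin n) ℝ) (R : Matrix (Fin m) (Fin m) ℝ)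
    (P : Matrix (Fin n) (Fin n) ℝ) : Prop :=
  P.PosSemidef ∧ Aᵀ * P + P * A - P * B * R⁻¹ * Bᵀ * P + Q = 0

/-- The sequences `P`, `K` are produced by Kleinman's algorithm started at `K₀`: `P i` is a
symmetric positive semidefinite solution of the Lyapunov equation for `K i`, and
`K (i + 1) = R⁻¹ Bᵀ P i`. -/
structure IsKleinman {n m : ℕ} (A : Matrix (Fin n) (Fin n) ℝ) (B : Matrix (Fin n) (Fin m) ℝ)
    (Q : Matrix (Fin n) (Fin n) ℝ) (R : Matrix (Fin m) (Fin m) ℝ) (K₀ : Matrix (Fin m) (Fin n) ℝ)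
    (P : ℕ → Matrix (Fin n) (Fin n) ℝ) (K : ℕ → Matrix (Fin m) (Fin n) ℝ) : Prop where
  init : K 0 = K₀
  posSemidef : ∀ i, (P i).PosSemidef
  lyapunov : ∀ i, (A - B * K i)ᵀ * P i + P i * (A - B * K i) + (K i)ᵀ * R * K i + Q = 0
  update : ∀ i, K (i + 1) = R⁻¹ * Bᵀ * P i

/-! ### The operators `v`, `𝓑`, `W`, `W_r⁻¹` -/

/-- The index set of the entries on and above the diagonal; it has `n (n + 1) / 2` elements. -/
abbrev Upper (n : ℕ) : Type := {p : Fin n × Fin n // p.1 ≤ p.2}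

theorem card_upper (n : ℕ) : Fintype.card (Upper n) = n * (n + 1) / 2 := by
  have h := Fintype.card_congr (Sym2.sortEquiv (α := Fin n))
  rw [Sym2.card, Fintype.card_fin, Nat.choose_two_right] at h
  rw [← h, Nat.add_sub_cancel, Nat.mul_comm]

/-- `v(P) = [p₁₁, 2 p₁₂, …, 2 p₁ₙ, p₂₂, 2 p₂₃, …, pₙₙ]`. -/
def vvec {n : ℕ} (P : Matrix (Fin n) (Fin n) ℝ) : Upper n → ℝ :=
  fun p => if p.1.1 = p.1.2 then P p.1.1 p.1.2 else 2 * P p.1.1 p.1.2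

/-- `𝓑(x, y)`, whose `(a, b)` entry (`a ≤ b`) is `(x_a y_b + x_b y_a) / 2`. -/
def bvec {n : ℕ} (x y : Fin n → ℝ) : Upper n → ℝ :=
  fun p => (1 / 2) * (x p.1.1 * y p.1.2 + x p.1.2 * y p.1.1)

/-- The Kronecker product of two vectors. -/
def kron {n : ℕ} (x y : Fin n → ℝ) : Fin n × Fin n → ℝ := fun p => x p.1 * y p.2

/-- The matrix `W` with `𝓑(x, y) = W (x ⊗ y)`; see `eq_wMat_iff`. -/
def wMat (n : ℕ) : Matrix (Upper n) (Fin n × Fin n) ℝ :=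
  fun p q => (1 / 2) * ((if q = p.1 then 1 else 0) + (if q = p.1.swap then 1 else 0))

/-- The right inverse `W_r⁻¹` of `W` with `x ⊗ x = W_r⁻¹ 𝓑(x, x)`; see `wMat_mul_wInv` and
`wInv_mulVec_bvec`. -/
def wInv (n : ℕ) : Matrix (Fin n × Fin n) (Upper n) ℝ :=
  fun q p => if q = p.1 ∨ q = p.1.swap then 1 else 0

theorem wMat_mulVec_kron {n : ℕ} (x y : Fin n → ℝ) : wMat n *ᵥ kron x y = bvec x y := by
  ext p
  simp only [Matrix.mulVec, dotProduct, wMat, kron, bvec, mul_assoc, add_mul, ite_mul, one_mul,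
    zero_mul, ← Finset.mul_sum, Finset.sum_add_distrib, Finset.sum_ite_eq',
    Finset.mem_univ, if_true, Prod.fst_swap, Prod.snd_swap]

theorem eq_wMat_iff {n : ℕ} (M : Matrix (Upper n) (Fin n × Fin n) ℝ) :
    M = wMat n ↔ ∀ x y : Fin n → ℝ, bvec x y = M *ᵥ kron x y := by
  constructor
  · rintro rfl x y
    exact (wMat_mulVec_kron x y).symm
  · intro h
    ext p ⟨a, b⟩
    have key : kron (Pi.single a (1 : ℝ)) (Pi.single b 1) = Pi.single (a, b) 1 := by
      ext ⟨c, d⟩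
      by_cases hc : c = a <;> by_cases hd : d = b <;> simp [kron, hc, hd]
    have h1 := congrFun ((h (Pi.single a 1) (Pi.single b 1)).symm.trans
      (wMat_mulVec_kron _ _).symm) p
    rw [key] at h1
    simpa using h1

theorem wMat_mul_wInv (n : ℕ) : wMat n * wInv n = 1 := by
  ext p q
  obtain ⟨⟨a, b⟩, hab⟩ := p
  obtain ⟨⟨c, d⟩, hcd⟩ := q
  simp only [Matrix.mul_apply, wMat, wInv, mul_assoc, add_mul, ite_mul, one_mul, zero_mul,
    ← Finset.mul_sum, Finset.sum_add_distrib, Finset.sum_ite_eq',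
    Finset.mem_univ, if_true, Matrix.one_apply, Subtype.mk.injEq, Prod.swap_prod_mk,
    Prod.mk.injEq]
  simp only at hab hcd
  have e : (b = c ∧ a = d ∨ b = d ∧ a = c) ↔ (a = c ∧ b = d) := by
    constructor
    · rintro (⟨rfl, rfl⟩ | ⟨rfl, rfl⟩)
      · exact ⟨le_antisymm hab hcd, le_antisymm hcd hab⟩
      · exact ⟨rfl, rfl⟩
    · rintro ⟨rfl, rfl⟩
      exact Or.inr ⟨rfl, rfl⟩
  have e' : (a = c ∧ b = d ∨ a = d ∧ b = c) ↔ (a = c ∧ b = d) := by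
    rw [← e]; tauto
  rw [if_congr e rfl rfl, if_congr e' rfl rfl]
  split_ifs <;> norm_num

theorem wInv_mulVec_bvec {n : ℕ} (x : Fin n → ℝ) : wInv n *ᵥ bvec x x = kron x x := by
  ext ⟨a, b⟩
  rcases le_total a b with hab | hab
  · rw [Matrix.mulVec, dotProduct, Finset.sum_eq_single (⟨(a, b), hab⟩ : Upper n)]
    · simp [wInv, bvec, kron]; ring
    · rintro ⟨⟨c, d⟩, hcd⟩ - hne
      have : ¬((a = c ∧ b = d) ∨ (a = d ∧ b = c)) := by
        rintro (⟨rfl, rfl⟩ | ⟨rfl, rfl⟩)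
        · exact hne rfl
        · exact hne (by simp only [Subtype.mk.injEq, Prod.mk.injEq]
                        exact ⟨le_antisymm hcd hab, le_antisymm hab hcd⟩)
      simp [wInv, this]
    · intro h; exact absurd (Finset.mem_univ _) h
  · rw [Matrix.mulVec, dotProduct, Finset.sum_eq_single (⟨(b, a), hab⟩ : Upper n)]
    · simp [wInv, bvec, kron]; ring
    · rintro ⟨⟨c, d⟩, hcd⟩ - hne
      have : ¬((a = c ∧ b = d) ∨ (a = d ∧ b = c)) := by
        rintro (⟨rfl, rfl⟩ | ⟨rfl, rfl⟩)
        · exact hne (by simp only [Subtype.mk.injEq, Prod.mk.injEq]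
                        exact ⟨le_antisymm hcd hab, le_antisymm hab hcd⟩)
        · exact hne rfl
      simp [wInv, this]
    · intro h; exact absurd (Finset.mem_univ _) h

/-! ### Data matrices -/

/-- The matrix `δ_{xy}`, with rows `𝓑(x(t_{k+1}) + y(t_k), x(t_{k+1}) - y(t_k))ᵀ`. -/
def deltaMat {n l : ℕ} (t : Fin (l + 1) → ℝ) (x y : ℝ → Fin n → ℝ) :
    Matrix (Fin l) (Upper n) ℝ :=
  fun k p => bvec (x (t k.succ) + y (t k.castSucc)) (x (t k.succ) - y (t k.castSucc)) p

/-- The matrix `I_{𝓑(x,y)}`, with rows `∫ 𝓑(x, y)ᵀ dτ` over `[t_k, t_{k+1}]`. -/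
def intMat {n l : ℕ} (t : Fin (l + 1) → ℝ) (x y : ℝ → Fin n → ℝ) :
    Matrix (Fin l) (Upper n) ℝ :=
  fun k p => ∫ τ in (t k.castSucc)..(t k.succ), bvec (x τ) (y τ) p

/-- `x` is a (Carathéodory) solution on `[a, b]` of `x' = f(x) + g(x) u`. -/
structure IsTrajectory {n m : ℕ} (f : (Fin n → ℝ) → Fin n → ℝ)
    (g : (Fin n → ℝ) → Matrix (Fin n) (Fin m) ℝ) (u : ℝ → Fin m → ℝ) (x : ℝ → Fin n → ℝ)
    (a b : ℝ) : Prop where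
  drift_integrable : IntervalIntegrable (fun τ => f (x τ)) volume a b
  input_integrable : IntervalIntegrable (fun τ => g (x τ) *ᵥ u τ) volume a b
  integral_eq : ∀ s ∈ Set.Icc a b, x s = x a + ∫ τ in a..s, (f (x τ) + g (x τ) *ᵥ u τ)

/-- `W_K = W (I ⊗ B K) W_r⁻¹`. -/
def wGain {n m : ℕ} (B : Matrix (Fin n) (Fin m) ℝ) (K : Matrix (Fin m) (Fin n) ℝ) :
    Matrix (Upper n) (Upper n) ℝ :=
  wMat n * ((1 : Matrix (Fin n) (Fin n) ℝ) ⊗ₖ (B * K)) * wInv n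

/-- The regression matrix `Θ = δ_{xx} - 2 [I_{𝓑(x,x)} W_Kᵀ + I_{𝓑(x,gu)} + I_{𝓑(x,w)}]` for the
gain `K`, where `w = f(x) - A x`. -/
def theta {n m l : ℕ} (f : (Fin n → ℝ) → Fin n → ℝ) (g : (Fin n → ℝ) → Matrix (Fin n) (Fin m) ℝ)
    (A : Matrix (Fin n) (Fin n) ℝ) (B : Matrix (Fin n) (Fin m) ℝ) (t : Fin (l + 1) → ℝ)
    (x : ℝ → Fin n → ℝ) (u : ℝ → Fin m → ℝ) (K : Matrix (Fin m) (Fin n) ℝ) :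
    Matrix (Fin l) (Upper n) ℝ :=
  deltaMat t x x - (2 : ℝ) • (intMat t x x * (wGain B K)ᵀ
    + intMat t x (fun τ => g (x τ) *ᵥ u τ) + intMat t x (fun τ => f (x τ) - A *ᵥ x τ))

/-- The regression target `Ξ = - I_{𝓑(x,x)} v(Q + Kᵀ R K)` for the gain `K`. -/
def xi {n m l : ℕ} (Q : Matrix (Fin n) (Fin n) ℝ) (R : Matrix (Fin m) (Fin m) ℝ)
    (t : Fin (l + 1) → ℝ) (x : ℝ → Fin n → ℝ) (K : Matrix (Fin m) (Fin n) ℝ) : Fin l → ℝ :=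
  -(intMat t x x *ᵥ vvec (Q + Kᵀ * R * K))

/-- `p` is a least-squares solution of `Θ p = Ξ`: it minimizes the Euclidean norm of the
residual. -/
def IsLeastSquares {ι κ : Type*} [Fintype ι] [Fintype κ] (Θ : Matrix ι κ ℝ) (Ξ : ι → ℝ)
    (p : κ → ℝ) : Prop :=
  ∀ q : κ → ℝ, ∑ k, ((Θ *ᵥ p) k - Ξ k) ^ 2 ≤ ∑ k, ((Θ *ᵥ q) k - Ξ k) ^ 2

/-- The sequences `P`, `K` are produced by the EIRL algorithm started at `K₀` and run on the data
`x`, `u` with sample instants `t`: `P i` is a symmetric matrix such that `v(P i)` is a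
least-squares solution of the regression for `K i`, and `K (i + 1) = R⁻¹ Bᵀ P i`. -/
structure IsEIRL {n m l : ℕ} (f : (Fin n → ℝ) → Fin n → ℝ)
    (g : (Fin n → ℝ) → Matrix (Fin n) (Fin m) ℝ)
    (A : Matrix (Fin n) (Fin n) ℝ) (B : Matrix (Fin n) (Fin m) ℝ)
    (Q : Matrix (Fin n) (Fin n) ℝ) (R : Matrix (Fin m) (Fin m) ℝ)
    (t : Fin (l + 1) → ℝ) (x : ℝ → Fin n → ℝ) (u : ℝ → Fin m → ℝ)
    (K₀ : Matrix (Fin m) (Fin n) ℝ)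
    (P : ℕ → Matrix (Fin n) (Fin n) ℝ) (K : ℕ → Matrix (Fin m) (Fin n) ℝ) : Prop where
  init : K 0 = K₀
  symm : ∀ i, (P i).IsSymm
  regression : ∀ i, IsLeastSquares (theta f g A B t x u (K i)) (xi Q R t x (K i)) (vvec (P i))
  update : ∀ i, K (i + 1) = R⁻¹ * Bᵀ * P i

end EIRL

end

noncomputable section

namespace EIRL

/-! ### Powers of elements of spectral radius less than one -/

/-! The regression is an exact rewriting of the Lyapunov equation. Along a trajectory, `xᵀPx` has
derivative `2xᵀP(f + gu)` almost everywhere, and since `w = f - Ax` absorbs the whole nonlinearity,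
subtracting `2xᵀP(BKx + gu + w)` leaves `2xᵀP(A - BK)x`. Integrated over the sample intervals, this
says that `Θ v(P)` is the data matrix applied to `v` of the Lyapunov operator at `P`
(`theta_mulVec_vvec`). Full column rank cancels the data matrix, so `Θ v(P) = Ξ` is the Lyapunov
equation for `K`. When `A - BK` is Hurwitz that equation is solvable, hence the least-squares
problem is consistent and its minimizers are exact solutions. By induction on the step, EIRL and
Kleinman's algorithm coincide.

Kleinman's algorithm rests on one completion of squares (`lyap_completion`): replacing `K` by
`R⁻¹BᵀP` changes the Lyapunov residual of `P` by a square. With detectability this keeps the closed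
loop Hurwitz; with positivity of Lyapunov solutions it makes the costs decrease and puts every
Riccati solution below them. The costs then converge, the limit solves the Riccati equation, and the
same comparison gives uniqueness.

The Lyapunov equation for Hurwitz `A` is handled by the Cayley transform `S = (1 + A)(1 - A)⁻¹`,
which turns it into a Stein equation, together with `Sᵏ → 0`, which follows from Gelfand's formula.
-/

/-- Gelfand's formula gives a geometric bound on `‖a ^ k‖`, with any ratio strictly between the
spectral radius and 1. -/
theorem tendsto_pow_zero_of_spectralRadius_lt_one {E : Type*} [NormedRing E] [NormedAlgebra ℂ E]
    [CompleteSpace E] {a : E} (ha : spectralRadius ℂ a < 1) :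
    Tendsto (fun k : ℕ => a ^ k) atTop (𝓝 0) := by
  obtain ⟨r, hr, hr1⟩ := ENNReal.lt_iff_exists_nnreal_btwn.1 ha
  have hr1' : r < 1 := by exact_mod_cast hr1
  have h := (spectrum.pow_nnnorm_pow_one_div_tendsto_nhds_spectralRadius a).eventually_lt_const hr
  have hb : ∀ᶠ k : ℕ in atTop, ‖a ^ k‖ ≤ (r : ℝ) ^ k := by
    filter_upwards [h, eventually_gt_atTop 0] with k hk hk0
    have hk' : (0 : ℝ) < k := by exact_mod_cast hk0
    have h1 := ENNReal.rpow_le_rpow hk.le hk'.le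
    rw [← ENNReal.rpow_mul, one_div, inv_mul_cancel₀ hk'.ne', ENNReal.rpow_one,
      ENNReal.rpow_natCast] at h1
    exact_mod_cast h1
  exact squeeze_zero_norm' hb (tendsto_pow_atTop_nhds_zero_of_lt_one r.2 hr1')

/-! ### Eigenvectors and Hurwitz matrices -/

theorem mem_spectrum_iff_exists_mulVec {ι : Type*} [Fintype ι] [DecidableEq ι] {𝕜 : Type*}
    [Field 𝕜] {M : Matrix ι ι 𝕜} {z : 𝕜} :
    z ∈ spectrum 𝕜 M ↔ ∃ v, v ≠ 0 ∧ M *ᵥ v = z • v := by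
  rw [spectrum.mem_iff, Matrix.isUnit_iff_isUnit_det, isUnit_iff_ne_zero, not_not,
    ← Matrix.exists_mulVec_eq_zero_iff]
  simp only [Matrix.sub_mulVec, sub_eq_zero, Algebra.algebraMap_eq_smul_one, Matrix.smul_mulVec,
    Matrix.one_mulVec, eq_comm]

theorem isHurwitz_iff {n : ℕ} {A : Matrix (Fin n) (Fin n) ℝ} :
    IsHurwitz A ↔ ∀ (z : ℂ) (v : Fin n → ℂ), v ≠ 0 →
      A.map (algebraMap ℝ ℂ) *ᵥ v = z • v → z.re < 0 := by
  simp only [IsHurwitz, mem_spectrum_iff_exists_mulVec]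
  exact ⟨fun h z v hv hz => h z ⟨v, hv, hz⟩, fun h z ⟨v, hv, hz⟩ => h z v hv hz⟩

/-- The real and imaginary parts of an eigenvector span an invariant subspace. -/
theorem IsHurwitz.not_exists_real {n : ℕ} {A : Matrix (Fin n) (Fin n) ℝ} (hA : IsHurwitz A)
    {a b : ℝ} {p q : Fin n → ℝ} (ha : 0 ≤ a) (hp : A *ᵥ p = a • p - b • q)
    (hq : A *ᵥ q = b • p + a • q) : p = 0 ∧ q = 0 := by
  by_contra hpq
  have hv : (fun i => (⟨p i, q i⟩ : ℂ)) ≠ 0 := by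
    intro h
    exact hpq ⟨funext fun i => congrArg Complex.re (congrFun h i),
      funext fun i => congrArg Complex.im (congrFun h i)⟩
  have := isHurwitz_iff.1 hA ⟨a, b⟩ _ hv (by
    ext i
    have h1 := congrFun hp i
    have h2 := congrFun hq i
    simp only [Matrix.mulVec, dotProduct, Pi.sub_apply, Pi.add_apply, Pi.smul_apply,
      smul_eq_mul] at h1 h2
    apply Complex.ext
    · simpa [Matrix.mulVec, dotProduct, Complex.mul_re] using h1
    · simp only [Matrix.mulVec, dotProduct, Matrix.map_apply, Complex.coe_algebraMap,
        Complex.im_sum, Pi.smul_apply, smul_eq_mul, Complex.mul_im, Complex.ofReal_re,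
        Complex.ofReal_im, zero_mul, add_zero]
      rw [h2]; ring)
  exact absurd this (not_lt.2 ha)

/-- Splitting an unstable eigenvector into real and imaginary parts lets Lyapunov arguments use real
quadratic forms only. -/
theorem exists_real_of_not_isHurwitz {n : ℕ} {A : Matrix (Fin n) (Fin n) ℝ} (hA : ¬ IsHurwitz A) :
    ∃ (a b : ℝ) (p q : Fin n → ℝ), 0 ≤ a ∧ ¬(p = 0 ∧ q = 0) ∧ A *ᵥ p = a • p - b • q ∧
      A *ᵥ q = b • p + a • q := by
  simp only [isHurwitz_iff, not_forall, not_lt] at hA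
  obtain ⟨z, v, hv, h, hz⟩ := hA
  refine ⟨z.re, z.im, fun i => (v i).re, fun i => (v i).im, hz, ?_, ?_, ?_⟩
  · rintro ⟨h1, h2⟩
    exact hv (funext fun i => Complex.ext (congrFun h1 i) (congrFun h2 i))
  · ext i
    have := congrArg Complex.re (congrFun h i)
    simpa [Matrix.mulVec, dotProduct, Complex.mul_re] using this
  · ext i
    have := congrArg Complex.im (congrFun h i)
    simp only [Matrix.mulVec, dotProduct, Matrix.map_apply, Complex.coe_algebraMap,
        Complex.im_sum, Pi.smul_apply, smul_eq_mul, Complex.mul_im, Complex.ofReal_re,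
        Complex.ofReal_im, zero_mul, add_zero] at this
    simp only [Matrix.mulVec, dotProduct, Pi.add_apply, Pi.smul_apply, smul_eq_mul]
    rw [this]; ring

section

attribute [local instance] Matrix.linftyOpNormedRing Matrix.linftyOpNormedAlgebra

theorem tendsto_pow_zero_of_spectrum {n : ℕ} {S : Matrix (Fin n) (Fin n) ℝ}
    (hS : ∀ z ∈ spectrum ℂ (S.map (algebraMap ℝ ℂ)), ‖z‖ < 1) :
    Tendsto (fun k : ℕ => S ^ k) atTop (𝓝 0) := by
  -- The spectral radius bound below needs a nontrivial algebra, so size 0 is treated apart.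
  rcases isEmpty_or_nonempty (Fin n) with h | h
  · exact tendsto_const_nhds.congr fun k => Subsingleton.elim _ _
  have h1 : spectralRadius ℂ (S.map (algebraMap ℝ ℂ)) < (1 : NNReal) :=
    spectrum.spectralRadius_lt_of_forall_lt _ fun z hz => by exact_mod_cast hS z hz
  have h2 := tendsto_pow_zero_of_spectralRadius_lt_one h1
  have h3 : ∀ k : ℕ, S ^ k = ((S.map (algebraMap ℝ ℂ)) ^ k).map Complex.re := by
    intro k
    have : (S.map (algebraMap ℝ ℂ)) ^ k = (S ^ k).map (algebraMap ℝ ℂ) :=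
      (map_pow (algebraMap ℝ ℂ).mapMatrix S k).symm
    rw [this]
    ext i j
    simp
  simp only [h3]
  have hc : Continuous fun M : Matrix (Fin n) (Fin n) ℂ => M.map Complex.re :=
    continuous_id.matrix_map Complex.continuous_re
  have := (hc.tendsto 0).comp h2
  rwa [Matrix.map_zero _ Complex.zero_re] at this

end

/-- The Cayley transform of a Hurwitz matrix is a contraction in the limit. -/
theorem IsHurwitz.exists_cayley {n : ℕ} {A : Matrix (Fin n) (Fin n) ℝ} (hA : IsHurwitz A) :
    ∃ T S : Matrix (Fin n) (Fin n) ℝ, (1 - A) * T = 1 ∧ (1 + A) * T = S ∧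
      Tendsto (fun k : ℕ => S ^ k) atTop (𝓝 0) := by
  have hdet : IsUnit (1 - A).det := by
    rw [isUnit_iff_ne_zero]
    intro h
    -- A kernel vector of `1 - A` would be an eigenvector of `A` for the eigenvalue 1.
    obtain ⟨v, hv, h⟩ := Matrix.exists_mulVec_eq_zero_iff.2 h
    rw [Matrix.sub_mulVec, Matrix.one_mulVec, sub_eq_zero] at h
    exact hv (hA.not_exists_real (a := 1) (b := 0) (q := 0) zero_le_one (by simp [← h])
      (by simp)).1
  refine ⟨(1 - A)⁻¹, (1 + A) * (1 - A)⁻¹, Matrix.mul_nonsing_inv _ hdet, rfl, ?_⟩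
  apply tendsto_pow_zero_of_spectrum
  intro z hz
  obtain ⟨v, hv, hz⟩ := mem_spectrum_iff_exists_mulVec.1 hz
  set c := (algebraMap ℝ ℂ).mapMatrix (m := Fin n) with hc
  have e1 : c (1 - A) * c (1 - A)⁻¹ = 1 := by
    rw [← map_mul, Matrix.mul_nonsing_inv _ hdet, map_one]
  -- In terms of `w`, the eigenvector equation reads `(1 + A) w = z (1 - A) w`, so `w` is an
  -- eigenvector of `A` for `(z - 1) / (1 + z)`.
  set w := c (1 - A)⁻¹ *ᵥ v with hw
  have e2 : c (1 - A) *ᵥ w = v := by rw [hw, Matrix.mulVec_mulVec, e1, Matrix.one_mulVec]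
  have hw0 : w ≠ 0 := by
    intro h
    rw [h, Matrix.mulVec_zero] at e2
    exact hv e2.symm
  have e3 : c (1 + A) *ᵥ w = z • v := by
    rw [hw, Matrix.mulVec_mulVec, ← map_mul]; exact hz
  rw [← e2, map_add, map_sub, map_one, Matrix.add_mulVec, Matrix.sub_mulVec, Matrix.one_mulVec] at e3
  have e4 : (1 + z) • (c A *ᵥ w) = (z - 1) • w := by
    ext i
    have := congrFun e3 i
    simp only [Pi.add_apply, Pi.smul_apply, Pi.sub_apply, smul_eq_mul] at this ⊢
    linear_combination this
  have hz1 : 1 + z ≠ 0 := by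
    intro h
    have h' : z = -1 := by linear_combination h
    rw [h, zero_smul, h'] at e4
    rcases smul_eq_zero.1 e4.symm with h | h
    · norm_num at h
    · exact hw0 h
  have e5 : c A *ᵥ w = ((z - 1) / (1 + z)) • w := by
    rw [div_eq_inv_mul, mul_smul, ← e4, smul_smul, inv_mul_cancel₀ hz1, one_smul]
  have h6 := isHurwitz_iff.1 hA _ w hw0 e5
  have h7 : 0 < Complex.normSq (1 + z) := Complex.normSq_pos.2 hz1
  -- The real part of `(z - 1) / (1 + z)` is `(|z|² - 1) / |1 + z|²`, so its negativity means `|z| <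
  -- 1`.
  rw [Complex.div_re, ← add_div, div_neg_iff] at h6
  rcases h6 with h6 | h6
  · exact absurd h6.2 (not_lt.2 h7.le)
  have h8 := h6.1
  simp only [Complex.sub_re, Complex.one_re, Complex.add_re, Complex.sub_im, Complex.one_im,
    Complex.add_im] at h8
  have h9 : ‖z‖ ^ 2 < 1 := by
    rw [← Complex.normSq_eq_norm_sq, Complex.normSq_apply]; nlinarith
  nlinarith [norm_nonneg z]

/-! ### The Lyapunov equation -/

/-- The Lyapunov operator `P ↦ Aᵀ P + P A`. -/
def lyap {n : ℕ} (A : Matrix (Fin n) (Fin n) ℝ) :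
    Matrix (Fin n) (Fin n) ℝ →ₗ[ℝ] Matrix (Fin n) (Fin n) ℝ where
  toFun P := Aᵀ * P + P * A
  map_add' P P' := by noncomm_ring
  map_smul' c P := by simp

theorem lyap_apply {n : ℕ} (A P : Matrix (Fin n) (Fin n) ℝ) : lyap A P = Aᵀ * P + P * A := rfl

theorem lyap_transpose {n : ℕ} (A P : Matrix (Fin n) (Fin n) ℝ) : lyap A Pᵀ = (lyap A P)ᵀ := by
  simp [lyap_apply, add_comm]

theorem dotProduct_lyap {n : ℕ} (A P : Matrix (Fin n) (Fin n) ℝ) (y : Fin n → ℝ) :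
    y ⬝ᵥ (lyap A P *ᵥ y) = (A *ᵥ y) ⬝ᵥ (P *ᵥ y) + y ⬝ᵥ (P *ᵥ (A *ᵥ y)) := by
  rw [lyap_apply, Matrix.add_mulVec, dotProduct_add, ← Matrix.mulVec_mulVec,
    ← Matrix.mulVec_mulVec, Matrix.dotProduct_mulVec, Matrix.vecMul_transpose]

/-- The forms `(1 ± A)ᵀ P (1 ± A)` differ by twice the Lyapunov operator; conjugating by `T` turns
the continuous-time equation into a discrete-time one, which can be iterated. -/
theorem stein_identity {n : ℕ} {A T S P : Matrix (Fin n) (Fin n) ℝ} (hT : (1 - A) * T = 1)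
    (hS : (1 + A) * T = S) : P = Sᵀ * P * S - (2 : ℝ) • (Tᵀ * lyap A P * T) := by
  have h1 : P = ((1 - A) * T)ᵀ * P * ((1 - A) * T) := by simp [hT]
  rw [← hS]
  conv_lhs => rw [h1]
  simp only [lyap_apply, Matrix.transpose_mul, Matrix.transpose_add, Matrix.transpose_sub,
    Matrix.transpose_one, two_smul]
  noncomm_ring

/-- A kernel element satisfies `D = (Sᵏ)ᵀ D Sᵏ` for all `k`, and the right side tends to 0. -/
theorem IsHurwitz.lyap_injective {n : ℕ} {A : Matrix (Fin n) (Fin n) ℝ} (hA : IsHurwitz A) :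
    Function.Injective (lyap A) := by
  rw [injective_iff_map_eq_zero]
  intro D hD
  obtain ⟨T, S, hT, hS, hlim⟩ := hA.exists_cayley
  have h1 : D = Sᵀ * D * S := by
    simpa [hD] using stein_identity (P := D) hT hS
  have h2 : ∀ k : ℕ, D = (S ^ k)ᵀ * D * S ^ k := by
    intro k
    induction k with
    | zero => simp
    | succ k ih =>
      rw [pow_succ, Matrix.transpose_mul]
      conv_lhs => rw [h1, ih]
      noncomm_ring
  have hc : Continuous fun M : Matrix (Fin n) (Fin n) ℝ => Mᵀ * D * M := by fun_prop
  have h3 := (hc.tendsto 0).comp hlim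
  simp only [Matrix.mul_zero] at h3
  exact tendsto_nhds_unique (tendsto_const_nhds.congr h2) h3

theorem IsHurwitz.lyap_surjective {n : ℕ} {A : Matrix (Fin n) (Fin n) ℝ} (hA : IsHurwitz A) :
    Function.Surjective (lyap A) :=
  LinearMap.injective_iff_surjective.1 hA.lyap_injective

/-- By the Stein identity the form of `P` does not increase under `S`, and it tends to 0 along `Sᵏ
y`, so it is nonnegative at `y`. Symmetry of `P` need not be assumed: `P` and `Pᵀ` have the same
Lyapunov image. -/
theorem IsHurwitz.posSemidef_of_lyap {n : ℕ} {A P : Matrix (Fin n) (Fin n) ℝ} (hA : IsHurwitz A)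
    (hP : (-lyap A P).PosSemidef) : P.PosSemidef := by
  have hsymm : P.IsHermitian := by
    have h := hP.1.eq
    rw [Matrix.conjTranspose_eq_transpose_of_trivial, Matrix.transpose_neg, neg_inj,
      ← lyap_transpose] at h
    exact (Matrix.conjTranspose_eq_transpose_of_trivial P).trans (hA.lyap_injective h)
  obtain ⟨T, S, hT, hS, hlim⟩ := hA.exists_cayley
  refine Matrix.PosSemidef.of_dotProduct_mulVec_nonneg hsymm fun y => ?_
  rw [star_trivial]
  have h1 : ∀ z : Fin n → ℝ, (S *ᵥ z) ⬝ᵥ (P *ᵥ (S *ᵥ z)) ≤ z ⬝ᵥ (P *ᵥ z) := by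
    intro z
    have h2 := hP.dotProduct_mulVec_nonneg (T *ᵥ z)
    rw [star_trivial, Matrix.neg_mulVec, dotProduct_neg] at h2
    have h3 : z ⬝ᵥ (P *ᵥ z) = (S *ᵥ z) ⬝ᵥ (P *ᵥ (S *ᵥ z))
        - 2 * ((T *ᵥ z) ⬝ᵥ (lyap A P *ᵥ (T *ᵥ z))) := by
      conv_lhs => rw [stein_identity (P := P) hT hS]
      simp only [Matrix.sub_mulVec, Matrix.smul_mulVec, dotProduct_sub, dotProduct_smul,
        smul_eq_mul, ← Matrix.mulVec_mulVec]
      rw [Matrix.dotProduct_mulVec z Sᵀ, Matrix.dotProduct_mulVec z Tᵀ, Matrix.vecMul_transpose,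
        Matrix.vecMul_transpose]
    linarith
  have h2 : ∀ k : ℕ, (S ^ k *ᵥ y) ⬝ᵥ (P *ᵥ (S ^ k *ᵥ y)) ≤ y ⬝ᵥ (P *ᵥ y) := by
    intro k
    induction k with
    | zero => simp
    | succ k ih =>
      rw [pow_succ', ← Matrix.mulVec_mulVec]
      exact (h1 _).trans ih
  have hc : Continuous fun M : Matrix (Fin n) (Fin n) ℝ => (M *ᵥ y) ⬝ᵥ (P *ᵥ (M *ᵥ y)) := by
    fun_prop
  have h3 := (hc.tendsto 0).comp hlim
  simp only [Matrix.zero_mulVec, zero_dotProduct] at h3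
  exact le_of_tendsto h3 (Eventually.of_forall h2)

/-! ### Real positive semidefinite matrices -/

theorem posSemidef_transpose_mul_mul {ι κ : Type*} [Fintype ι] [Fintype κ] {R : Matrix ι ι ℝ}
    (hR : R.PosSemidef) (K : Matrix ι κ ℝ) : (Kᵀ * R * K).PosSemidef := by
  simpa [Matrix.conjTranspose_eq_transpose_of_trivial] using hR.conjTranspose_mul_mul_same K

theorem dotProduct_transpose_mul_mul {ι κ : Type*} [Fintype ι] [Fintype κ] (R : Matrix ι ι ℝ)
    (K : Matrix ι κ ℝ) (y : κ → ℝ) :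
    y ⬝ᵥ ((Kᵀ * R * K) *ᵥ y) = (K *ᵥ y) ⬝ᵥ (R *ᵥ (K *ᵥ y)) := by
  rw [← Matrix.mulVec_mulVec, ← Matrix.mulVec_mulVec, Matrix.dotProduct_mulVec y,
    Matrix.vecMul_transpose]

theorem isSymm_of_posSemidef {ι : Type*} [Fintype ι] {P : Matrix ι ι ℝ} (hP : P.PosSemidef) :
    P.IsSymm :=
  (Matrix.conjTranspose_eq_transpose_of_trivial P).symm.trans hP.1.eq

theorem sqrt_mulVec_eq_zero {ι : Type*} [Fintype ι] [DecidableEq ι] {Q : Matrix ι ι ℝ}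
    (hQ : Q.PosSemidef) {y : ι → ℝ} (hy : y ⬝ᵥ (Q *ᵥ y) = 0) : CFC.sqrt Q *ᵥ y = 0 := by
  have h1 : CFC.sqrt Q * CFC.sqrt Q = Q := CFC.sqrt_mul_sqrt_self Q hQ.nonneg
  have h2 : (CFC.sqrt Q)ᵀ = CFC.sqrt Q :=
    isSymm_of_posSemidef (Matrix.nonneg_iff_posSemidef.1 (CFC.sqrt_nonneg Q))
  rw [← h1, ← Matrix.mulVec_mulVec, Matrix.dotProduct_mulVec, ← Matrix.mulVec_transpose, h2] at hy
  exact dotProduct_self_eq_zero.1 hy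

/-- A decreasing sequence of positive semidefinite matrices converges. -/
theorem exists_tendsto_of_antitone_posSemidef {n : ℕ} {P : ℕ → Matrix (Fin n) (Fin n) ℝ}
    (hP : ∀ i, (P i).PosSemidef) (hanti : ∀ i, P (i + 1) ≤ P i) :
    ∃ Pinf, Tendsto P atTop (𝓝 Pinf) := by
  have hq : ∀ y : Fin n → ℝ, ∃ c, Tendsto (fun i => y ⬝ᵥ (P i *ᵥ y)) atTop (𝓝 c) := by
    intro y
    refine ⟨_, tendsto_atTop_ciInf (antitone_nat_of_succ_le fun i => ?_) ⟨0, ?_⟩⟩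
    · have := (Matrix.le_iff.1 (hanti i)).dotProduct_mulVec_nonneg y
      rw [star_trivial, Matrix.sub_mulVec, dotProduct_sub] at this
      linarith
    · rintro _ ⟨i, rfl⟩
      simpa using (hP i).dotProduct_mulVec_nonneg y
  choose c hc using hq
  -- Each quadratic form value converges by monotonicity; polarization on basis vectors recovers the
  -- entries.
  refine ⟨fun a b => (1 / 2) * (c (Pi.single a 1 + Pi.single b 1) - c (Pi.single a 1)
    - c (Pi.single b 1)), tendsto_pi_nhds.2 fun a => tendsto_pi_nhds.2 fun b => ?_⟩
  refine ((((hc (Pi.single a 1 + Pi.single b 1)).sub (hc (Pi.single a 1))).sub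
    (hc (Pi.single b 1))).const_mul (1 / 2)).congr fun i => ?_
  have hs : P i b a = P i a b := (isSymm_of_posSemidef (hP i)).apply a b
  simp only [Matrix.mulVec_add, dotProduct_add, add_dotProduct, Matrix.mulVec_single_one,
    single_one_dotProduct, Matrix.col_apply]
  rw [hs]; ring

theorem posSemidef_of_tendsto {n : ℕ} {P : ℕ → Matrix (Fin n) (Fin n) ℝ}
    {Pinf : Matrix (Fin n) (Fin n) ℝ} (hP : ∀ i, (P i).PosSemidef)
    (hlim : Tendsto P atTop (𝓝 Pinf)) : Pinf.PosSemidef := by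
  refine Matrix.PosSemidef.of_dotProduct_mulVec_nonneg ?_ fun y => ?_
  · have hc : Continuous fun M : Matrix (Fin n) (Fin n) ℝ => Mᴴ := by fun_prop
    exact tendsto_nhds_unique (((hc.tendsto _).comp hlim).congr fun i => (hP i).1.eq) hlim
  · have hc : Continuous fun M : Matrix (Fin n) (Fin n) ℝ => star y ⬝ᵥ (M *ᵥ y) := by fun_prop
    exact ge_of_tendsto ((hc.tendsto _).comp hlim)
      (Eventually.of_forall fun i => (hP i).dotProduct_mulVec_nonneg y)

/-! ### Closed loops -/

section ClosedLoop

variable {n m : ℕ} {A : Matrix (Fin n) (Fin n) ℝ} {B : Matrix (Fin n) (Fin m) ℝ}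
  {Q : Matrix (Fin n) (Fin n) ℝ} {R : Matrix (Fin m) (Fin m) ℝ}

theorem mulVec_eq_zero_of_cost_nonpos (hQ : Q.PosSemidef) (hR : R.PosDef)
    {K : Matrix (Fin m) (Fin n) ℝ} {y : Fin n → ℝ} (hy : y ⬝ᵥ ((Kᵀ * R * K + Q) *ᵥ y) ≤ 0) :
    K *ᵥ y = 0 ∧ CFC.sqrt Q *ᵥ y = 0 := by
  rw [Matrix.add_mulVec, dotProduct_add, dotProduct_transpose_mul_mul] at hy
  have h1 := hQ.dotProduct_mulVec_nonneg y
  have h2 := hR.posSemidef.dotProduct_mulVec_nonneg (K *ᵥ y)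
  rw [star_trivial] at h1 h2
  refine ⟨?_, sqrt_mulVec_eq_zero hQ (le_antisymm (by linarith) h1)⟩
  by_contra h
  have h3 := hR.dotProduct_mulVec_pos h
  rw [star_trivial] at h3
  linarith

/-- Lyapunov's criterion for a detectable cost. -/
theorem isHurwitz_of_lyap_le (hQ : Q.PosSemidef) (hR : R.PosDef)
    (hdet : IsDetectable (CFC.sqrt Q) A) {K : Matrix (Fin m) (Fin n) ℝ}
    {P : Matrix (Fin n) (Fin n) ℝ} (hP : P.PosSemidef)
    (hle : Kᵀ * R * K + Q ≤ -lyap (A - B * K) P) : IsHurwitz (A - B * K) := by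
  by_contra hA
  obtain ⟨a, b, p, q, ha, hpq, hp, hq⟩ := exists_real_of_not_isHurwitz hA
  have hcost : ∀ y : Fin n → ℝ, y ⬝ᵥ ((Kᵀ * R * K + Q) *ᵥ y)
      ≤ -(y ⬝ᵥ (lyap (A - B * K) P *ᵥ y)) := by
    intro y
    have := (Matrix.le_iff.1 hle).dotProduct_mulVec_nonneg y
    rw [star_trivial, Matrix.sub_mulVec, dotProduct_sub, Matrix.neg_mulVec, dotProduct_neg] at this
    linarith
  have hnn : ∀ y : Fin n → ℝ, 0 ≤ y ⬝ᵥ ((Kᵀ * R * K + Q) *ᵥ y) := fun y => by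
    simpa using ((posSemidef_transpose_mul_mul hR.posSemidef K).add hQ).dotProduct_mulVec_nonneg y
  have hPp := hP.dotProduct_mulVec_nonneg p
  have hPq := hP.dotProduct_mulVec_nonneg q
  rw [star_trivial] at hPp hPq
  -- The `b` terms cancel in the sum. With `a ≥ 0` the sum is nonnegative, whereas the cost
  -- inequality makes it nonpositive, so the cost vanishes at `p` and `q`.
  have hsum : p ⬝ᵥ (lyap (A - B * K) P *ᵥ p) + q ⬝ᵥ (lyap (A - B * K) P *ᵥ q)
      = 2 * a * (p ⬝ᵥ (P *ᵥ p) + q ⬝ᵥ (P *ᵥ q)) := by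
    rw [dotProduct_lyap, dotProduct_lyap, hp, hq]
    simp only [Matrix.mulVec_add, Matrix.mulVec_sub, Matrix.mulVec_smul, dotProduct_add,
      dotProduct_sub, add_dotProduct, sub_dotProduct, dotProduct_smul, smul_dotProduct,
      smul_eq_mul]
    ring
  have hpos : 0 ≤ 2 * a * (p ⬝ᵥ (P *ᵥ p) + q ⬝ᵥ (P *ᵥ q)) := by positivity
  have h1 := hcost p
  have h2 := hcost q
  have h3 := hnn p
  have h4 := hnn q
  obtain ⟨hKp, hCp⟩ := mulVec_eq_zero_of_cost_nonpos hQ hR (K := K) (y := p) (by linarith)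
  obtain ⟨hKq, hCq⟩ := mulVec_eq_zero_of_cost_nonpos hQ hR (K := K) (y := q) (by linarith)
  -- Both `K` and `Q^{1/2}` annihilate `p` and `q`, so there `A - BK` agrees with the Hurwitz matrix
  -- `A - L Q^{1/2}`.
  obtain ⟨L, hL⟩ := hdet
  refine hpq (hL.not_exists_real ha (b := b) ?_ ?_)
  · rw [← hp, Matrix.sub_mulVec, Matrix.sub_mulVec, ← Matrix.mulVec_mulVec, hCp,
      ← Matrix.mulVec_mulVec, hKp, Matrix.mulVec_zero, Matrix.mulVec_zero]
  · rw [← hq, Matrix.sub_mulVec, Matrix.sub_mulVec, ← Matrix.mulVec_mulVec, hCq,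
      ← Matrix.mulVec_mulVec, hKq, Matrix.mulVec_zero, Matrix.mulVec_zero]

/-- Completion of squares for the gain `R⁻¹ Bᵀ P`. -/
theorem lyap_completion (hR : R.PosDef) {P : Matrix (Fin n) (Fin n) ℝ} (hP : P.IsSymm)
    {K K' : Matrix (Fin m) (Fin n) ℝ} (hK' : K' = R⁻¹ * Bᵀ * P) :
    lyap (A - B * K') P + (K'ᵀ * R * K' + Q) + (K - K')ᵀ * R * (K - K')
      = lyap (A - B * K) P + (Kᵀ * R * K + Q) := by
  have h1 : R * K' = Bᵀ * P := by
    rw [hK', Matrix.mul_assoc, ← Matrix.mul_assoc,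
      Matrix.mul_nonsing_inv _ ((Matrix.isUnit_iff_isUnit_det _).1 hR.isUnit), Matrix.one_mul]
  have h2 : P * B = K'ᵀ * R := by
    have := congrArg Matrix.transpose h1
    rw [Matrix.transpose_mul, Matrix.transpose_mul, Matrix.transpose_transpose, hP.eq,
      (isSymm_of_posSemidef hR.posSemidef).eq] at this
    exact this.symm
  -- Writing `BᵀP` as `R K'` makes the dependence on the gain `L` explicit; the identity is then the
  -- expansion of the square.
  have h3 : ∀ L : Matrix (Fin m) (Fin n) ℝ, lyap (A - B * L) P
      = lyap A P - Lᵀ * (R * K') - K'ᵀ * R * L := by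
    intro L
    rw [h1, ← h2, lyap_apply, lyap_apply, Matrix.transpose_sub, Matrix.transpose_mul,
      Matrix.sub_mul, Matrix.mul_sub, Matrix.mul_assoc, Matrix.mul_assoc]
    abel
  rw [h3, h3, Matrix.transpose_sub]
  simp only [Matrix.sub_mul, Matrix.mul_sub, Matrix.mul_assoc]
  abel

/-- The Riccati equation is the Lyapunov equation of the gain that `P` itself induces: this is
completion of squares against the zero gain. -/
theorem solvesCARE_iff (hR : R.PosDef) {P : Matrix (Fin n) (Fin n) ℝ} :
    SolvesCARE A B Q R P ↔ P.PosSemidef ∧ lyap (A - B * (R⁻¹ * Bᵀ * P)) P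
      + ((R⁻¹ * Bᵀ * P)ᵀ * R * (R⁻¹ * Bᵀ * P) + Q) = 0 := by
  refine and_congr_right fun hP => ?_
  have hRu := (Matrix.isUnit_iff_isUnit_det _).1 hR.isUnit
  have h := lyap_completion (A := A) (B := B) (Q := Q) hR (isSymm_of_posSemidef hP) (K := 0) rfl
  simp only [Matrix.mul_zero, Matrix.transpose_zero, Matrix.zero_mul, sub_zero, zero_add] at h
  rw [eq_sub_of_add_eq h, lyap_apply]
  have h2 : (0 - R⁻¹ * Bᵀ * P)ᵀ * R * (0 - R⁻¹ * Bᵀ * P) = P * B * R⁻¹ * Bᵀ * P := by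
    have hRi : (R⁻¹)ᵀ = R⁻¹ := by
      rw [Matrix.transpose_nonsing_inv, (isSymm_of_posSemidef hR.posSemidef).eq]
    simp only [zero_sub, Matrix.transpose_neg, Matrix.transpose_mul, Matrix.transpose_transpose,
      Matrix.neg_mul, Matrix.mul_neg, neg_neg, (isSymm_of_posSemidef hP).eq, hRi]
    calc P * (B * R⁻¹) * R * (R⁻¹ * Bᵀ * P) = P * B * (R⁻¹ * R) * R⁻¹ * Bᵀ * P := by
          simp only [Matrix.mul_assoc]
      _ = _ := by rw [Matrix.nonsing_inv_mul _ hRu, Matrix.mul_one]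
  rw [h2]
  exact iff_of_eq (congrArg (· = 0) (by abel))

theorem posSemidef_cost (hQ : Q.PosSemidef) (hR : R.PosDef) (K : Matrix (Fin m) (Fin n) ℝ) :
    (Kᵀ * R * K + Q).PosSemidef :=
  (posSemidef_transpose_mul_mul hR.posSemidef K).add hQ

/-- One step of policy improvement preserves stability. -/
theorem isHurwitz_update (hQ : Q.PosSemidef) (hR : R.PosDef)
    (hdet : IsDetectable (CFC.sqrt Q) A) {P : Matrix (Fin n) (Fin n) ℝ} (hP : P.PosSemidef)
    {K : Matrix (Fin m) (Fin n) ℝ} (hL : lyap (A - B * K) P + (Kᵀ * R * K + Q) = 0) :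
    IsHurwitz (A - B * (R⁻¹ * Bᵀ * P)) := by
  refine isHurwitz_of_lyap_le hQ hR hdet hP (Matrix.le_iff.2 ?_)
  have h := lyap_completion (A := A) (B := B) (Q := Q) hR (isSymm_of_posSemidef hP) (K := K) rfl
  rw [hL] at h
  have h2 := posSemidef_transpose_mul_mul hR.posSemidef (K - R⁻¹ * Bᵀ * P)
  rw [eq_neg_of_add_eq_zero_right h, neg_add, ← sub_eq_add_neg] at h2
  exact h2

/-- One step of policy improvement decreases the cost. -/
theorem le_of_update (hR : R.PosDef) {P P' : Matrix (Fin n) (Fin n) ℝ} (hP : P.PosSemidef)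
    {K K' : Matrix (Fin m) (Fin n) ℝ} (hK' : K' = R⁻¹ * Bᵀ * P)
    (hA' : IsHurwitz (A - B * K'))
    (hL : lyap (A - B * K) P + (Kᵀ * R * K + Q) = 0)
    (hL' : lyap (A - B * K') P' + (K'ᵀ * R * K' + Q) = 0) : P' ≤ P := by
  refine Matrix.le_iff.2 (hA'.posSemidef_of_lyap ?_)
  -- Subtracting the two Lyapunov equations leaves minus the Lyapunov image of `P - P'` equal to `(K
  -- - K')ᵀ R (K - K')`.
  have h := lyap_completion (A := A) (B := B) (Q := Q) hR (isSymm_of_posSemidef hP) (K := K) hK'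
  rw [hL] at h
  convert posSemidef_transpose_mul_mul hR.posSemidef (K - K') using 1
  rw [map_sub, eq_neg_of_add_eq_zero_left hL', neg_eq_iff_add_eq_zero, ← h]
  abel

/-- The optimal cost is a lower bound for the cost of every stabilizing gain. -/
theorem care_le (hR : R.PosDef) {P Pstar : Matrix (Fin n) (Fin n) ℝ}
    (hstar : SolvesCARE A B Q R Pstar) {K : Matrix (Fin m) (Fin n) ℝ}
    (hA : IsHurwitz (A - B * K)) (hL : lyap (A - B * K) P + (Kᵀ * R * K + Q) = 0) :
    Pstar ≤ P := by
  refine Matrix.le_iff.2 (hA.posSemidef_of_lyap ?_)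
  rw [solvesCARE_iff hR] at hstar
  have h := lyap_completion (A := A) (B := B) (Q := Q) hR (isSymm_of_posSemidef hstar.1)
    (K := K) rfl
  rw [hstar.2, zero_add] at h
  convert posSemidef_transpose_mul_mul hR.posSemidef (K - R⁻¹ * Bᵀ * Pstar) using 1
  rw [h, map_sub, eq_neg_of_add_eq_zero_left hL]
  abel

theorem SolvesCARE.isHurwitz (hQ : Q.PosSemidef) (hR : R.PosDef)
    (hdet : IsDetectable (CFC.sqrt Q) A) {P : Matrix (Fin n) (Fin n) ℝ}
    (hP : SolvesCARE A B Q R P) : IsHurwitz (A - B * (R⁻¹ * Bᵀ * P)) :=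
  isHurwitz_update hQ hR hdet hP.1 ((solvesCARE_iff hR).1 hP).2

/-- Each solution is the cost of its own gain, which is stabilizing by detectability, hence is
bounded below by the other. -/
theorem SolvesCARE.unique (hQ : Q.PosSemidef) (hR : R.PosDef)
    (hdet : IsDetectable (CFC.sqrt Q) A) {P P' : Matrix (Fin n) (Fin n) ℝ}
    (hP : SolvesCARE A B Q R P) (hP' : SolvesCARE A B Q R P') : P = P' :=
  le_antisymm (care_le hR hP (hP'.isHurwitz hQ hR hdet) ((solvesCARE_iff hR).1 hP').2)
    (care_le hR hP' (hP.isHurwitz hQ hR hdet) ((solvesCARE_iff hR).1 hP).2)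

/-- The kernel of `P` is `A`-invariant and contained in the kernel of `Q^{1/2}`, hence in the
unobservable subspace. -/
theorem posDef_of_observable (hQ : Q.PosSemidef) (hR : R.PosDef)
    (hobs : IsObservable (CFC.sqrt Q) A) {P : Matrix (Fin n) (Fin n) ℝ} (hP : P.PosSemidef)
    {K : Matrix (Fin m) (Fin n) ℝ} (hL : lyap (A - B * K) P + (Kᵀ * R * K + Q) = 0) :
    P.PosDef := by
  have hker : ∀ z : Fin n → ℝ, P *ᵥ z = 0 → CFC.sqrt Q *ᵥ z = 0 ∧ P *ᵥ (A *ᵥ z) = 0 := by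
    intro z hz
    have h1 : z ⬝ᵥ (lyap (A - B * K) P *ᵥ z) = 0 := by
      rw [dotProduct_lyap, hz, dotProduct_zero, zero_add, Matrix.dotProduct_mulVec,
        ← Matrix.mulVec_transpose, (isSymm_of_posSemidef hP).eq, hz, zero_dotProduct]
    have h2 : z ⬝ᵥ ((Kᵀ * R * K + Q) *ᵥ z) = 0 := by
      rw [eq_neg_of_add_eq_zero_right hL, Matrix.neg_mulVec, dotProduct_neg, h1, neg_zero]
    obtain ⟨hK, hC⟩ := mulVec_eq_zero_of_cost_nonpos hQ hR h2.le
    refine ⟨hC, ?_⟩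
    have h3 : (Kᵀ * R * K + Q) *ᵥ z = 0 :=
      ((posSemidef_cost hQ hR K).dotProduct_mulVec_zero_iff z).1 (by rwa [star_trivial])
    have h4 := congrArg (· *ᵥ z) hL
    simp only [h3, lyap_apply, Matrix.add_mulVec,
      Matrix.zero_mulVec, add_zero, ← Matrix.mulVec_mulVec, hz, Matrix.mulVec_zero, zero_add,
      Matrix.sub_mulVec, hK, sub_zero] at h4
    simpa [Matrix.add_mulVec, Matrix.sub_mulVec, ← Matrix.mulVec_mulVec, hK] using h4
  refine Matrix.PosDef.of_dotProduct_mulVec_pos hP.1 fun z hz => ?_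
  refine lt_of_le_of_ne (hP.dotProduct_mulVec_nonneg z) fun h0 => hz (hobs z fun k => ?_)
  have hPk : ∀ k : ℕ, P *ᵥ (A ^ k *ᵥ z) = 0 := by
    intro k
    induction k with
    | zero => simpa using (hP.dotProduct_mulVec_zero_iff z).1 h0.symm
    | succ k ih =>
      rw [pow_succ', ← Matrix.mulVec_mulVec]
      exact (hker _ ih).2
  rw [← Matrix.mulVec_mulVec]
  exact (hker _ (hPk k)).1

end ClosedLoop

/-! ### Kleinman's algorithm -/

/-- The solution of `Aᵀ P + P A + M = 0` if `A` is Hurwitz. -/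
def lyapSolution {n : ℕ} (A M : Matrix (Fin n) (Fin n) ℝ) : Matrix (Fin n) (Fin n) ℝ :=
  Function.invFun (lyap A) (-M)

theorem IsHurwitz.lyap_add_eq_zero_iff {n : ℕ} {A M P : Matrix (Fin n) (Fin n) ℝ}
    (hA : IsHurwitz A) : lyap A P + M = 0 ↔ P = lyapSolution A M := by
  have h : lyap A (lyapSolution A M) = -M := Function.invFun_eq (hA.lyap_surjective (-M))
  rw [add_eq_zero_iff_eq_neg, ← h, hA.lyap_injective.eq_iff]

section Kleinman

variable {n m : ℕ} (A : Matrix (Fin n) (Fin n) ℝ) (B : Matrix (Fin n) (Fin m) ℝ)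
  (Q : Matrix (Fin n) (Fin n) ℝ) (R : Matrix (Fin m) (Fin m) ℝ) (K₀ : Matrix (Fin m) (Fin n) ℝ)

/-- The cost matrix of the gain `K`. -/
def costMat (K : Matrix (Fin m) (Fin n) ℝ) : Matrix (Fin n) (Fin n) ℝ :=
  lyapSolution (A - B * K) (Kᵀ * R * K + Q)

/-- The gains of Kleinman's algorithm. -/
def kleinmanGain : ℕ → Matrix (Fin m) (Fin n) ℝ
  | 0 => K₀
  | i + 1 => R⁻¹ * Bᵀ * costMat A B Q R (kleinmanGain i)

/-- The cost matrices of Kleinman's algorithm. -/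
def kleinmanCost (i : ℕ) : Matrix (Fin n) (Fin n) ℝ :=
  costMat A B Q R (kleinmanGain A B Q R K₀ i)

variable {A B Q R K₀}

theorem lyap_costMat {K : Matrix (Fin m) (Fin n) ℝ} (hK : IsHurwitz (A - B * K)) :
    lyap (A - B * K) (costMat A B Q R K) + (Kᵀ * R * K + Q) = 0 :=
  hK.lyap_add_eq_zero_iff.2 rfl

theorem posSemidef_costMat (hQ : Q.PosSemidef) (hR : R.PosDef) {K : Matrix (Fin m) (Fin n) ℝ}
    (hK : IsHurwitz (A - B * K)) : (costMat A B Q R K).PosSemidef := by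
  refine hK.posSemidef_of_lyap ?_
  rw [eq_neg_of_add_eq_zero_left (lyap_costMat hK), neg_neg]
  exact posSemidef_cost hQ hR K

theorem isHurwitz_kleinmanGain (hQ : Q.PosSemidef) (hR : R.PosDef)
    (hdet : IsDetectable (CFC.sqrt Q) A) (hK₀ : IsHurwitz (A - B * K₀)) (i : ℕ) :
    IsHurwitz (A - B * kleinmanGain A B Q R K₀ i) := by
  induction i with
  | zero => exact hK₀
  | succ i ih => exact isHurwitz_update hQ hR hdet (posSemidef_costMat hQ hR ih) (lyap_costMat ih)

/-- A policy iteration whose evaluation step solves the Lyapunov equation as long as the gain is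
stabilizing coincides with Kleinman's algorithm. -/
theorem eq_kleinman (hQ : Q.PosSemidef) (hR : R.PosDef)
    (hdet : IsDetectable (CFC.sqrt Q) A) (hK₀ : IsHurwitz (A - B * K₀))
    {P : ℕ → Matrix (Fin n) (Fin n) ℝ} {K : ℕ → Matrix (Fin m) (Fin n) ℝ} (h0 : K 0 = K₀)
    (hP : ∀ i, IsHurwitz (A - B * K i) →
      lyap (A - B * K i) (P i) + ((K i)ᵀ * R * K i + Q) = 0)
    (hK : ∀ i, K (i + 1) = R⁻¹ * Bᵀ * P i) :
    P = kleinmanCost A B Q R K₀ ∧ K = kleinmanGain A B Q R K₀ := by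
  have hH := isHurwitz_kleinmanGain hQ hR hdet hK₀
  have hstep : ∀ i, K i = kleinmanGain A B Q R K₀ i → P i = kleinmanCost A B Q R K₀ i := by
    intro i hi
    have := hP i (hi ▸ hH i)
    rw [hi] at this
    exact (hH i).lyap_add_eq_zero_iff.1 this
  -- Stability of `K i` is not known beforehand; it comes from the identification with Kleinman's
  -- gain at the same step.
  have hKi : ∀ i, K i = kleinmanGain A B Q R K₀ i := by
    intro i
    induction i with
    | zero => exact h0
    | succ i ih => rw [hK, hstep i ih]; rfl
  exact ⟨funext fun i => hstep i (hKi i), funext hKi⟩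

theorem isKleinman_iff (hQ : Q.PosSemidef) (hR : R.PosDef)
    (hdet : IsDetectable (CFC.sqrt Q) A) (hK₀ : IsHurwitz (A - B * K₀))
    {P : ℕ → Matrix (Fin n) (Fin n) ℝ} {K : ℕ → Matrix (Fin m) (Fin n) ℝ} :
    IsKleinman A B Q R K₀ P K ↔ P = kleinmanCost A B Q R K₀ ∧ K = kleinmanGain A B Q R K₀ := by
  have hH := isHurwitz_kleinmanGain hQ hR hdet hK₀
  constructor
  · intro h
    refine eq_kleinman hQ hR hdet hK₀ h.init (fun i _ => ?_) h.update
    rw [← add_assoc]; exact h.lyapunov i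
  · rintro ⟨rfl, rfl⟩
    refine ⟨rfl, fun i => posSemidef_costMat hQ hR (hH i), fun i => ?_, fun i => rfl⟩
    have := lyap_costMat (Q := Q) (R := R) (hH i)
    rwa [← add_assoc] at this

theorem exists_care_tendsto_kleinman (hQ : Q.PosSemidef) (hR : R.PosDef)
    (hdet : IsDetectable (CFC.sqrt Q) A) (hK₀ : IsHurwitz (A - B * K₀)) :
    ∃ Pstar, (∀ P, SolvesCARE A B Q R P ↔ P = Pstar) ∧
      (∀ i, Pstar ≤ kleinmanCost A B Q R K₀ i ∧
        kleinmanCost A B Q R K₀ (i + 1) ≤ kleinmanCost A B Q R K₀ i) ∧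
      Tendsto (kleinmanGain A B Q R K₀) atTop (𝓝 (R⁻¹ * Bᵀ * Pstar)) ∧
      Tendsto (kleinmanCost A B Q R K₀) atTop (𝓝 Pstar) := by
  have hH := isHurwitz_kleinmanGain hQ hR hdet hK₀
  have hpsd : ∀ i, (kleinmanCost A B Q R K₀ i).PosSemidef := fun i =>
    posSemidef_costMat hQ hR (hH i)
  have hanti : ∀ i, kleinmanCost A B Q R K₀ (i + 1) ≤ kleinmanCost A B Q R K₀ i := fun i =>
    le_of_update hR (hpsd i) rfl (hH (i + 1)) (lyap_costMat (hH i)) (lyap_costMat (hH (i + 1)))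
  obtain ⟨Pstar, hlim⟩ := exists_tendsto_of_antitone_posSemidef hpsd hanti
  have hc : Continuous fun P : Matrix (Fin n) (Fin n) ℝ => R⁻¹ * Bᵀ * P := by fun_prop
  have hlimK : Tendsto (kleinmanGain A B Q R K₀) atTop (𝓝 (R⁻¹ * Bᵀ * Pstar)) :=
    -- The gain at `i + 1` is a continuous function of the cost at `i`, hence the shift by one.
    (tendsto_add_atTop_iff_nat 1).1 ((hc.tendsto Pstar).comp hlim)
  have hcare : SolvesCARE A B Q R Pstar := by
    refine (solvesCARE_iff hR).2 ⟨posSemidef_of_tendsto hpsd hlim, ?_⟩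
    have hc2 : Continuous fun p : Matrix (Fin n) (Fin n) ℝ × Matrix (Fin m) (Fin n) ℝ =>
        lyap (A - B * p.2) p.1 + (p.2ᵀ * R * p.2 + Q) := by
      simp only [lyap_apply]; fun_prop
    have h := (hc2.tendsto (Pstar, R⁻¹ * Bᵀ * Pstar)).comp (hlim.prodMk_nhds hlimK)
    exact tendsto_nhds_unique h
      (tendsto_const_nhds.congr fun i => (lyap_costMat (hH i)).symm)
  exact ⟨Pstar, fun P => ⟨fun hP => hP.unique hQ hR hdet hcare, fun h => h ▸ hcare⟩,
    fun i => ⟨care_le hR hcare (hH i) (lyap_costMat (hH i)), hanti i⟩, hlimK, hlim⟩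

end Kleinman

/-! ### Integration along trajectories -/

/-- Integration by parts for absolutely continuous functions, as Carathéodory solutions need only be
differentiable almost everywhere. -/
theorem integral_mul_add_mul_eq_sub {F G f g : ℝ → ℝ} {a b : ℝ} (hab : a ≤ b)
    (hf : IntervalIntegrable f volume a b) (hg : IntervalIntegrable g volume a b)
    (hF : ∀ s ∈ Set.Icc a b, F s = F a + ∫ τ in a..s, f τ)
    (hG : ∀ s ∈ Set.Icc a b, G s = G a + ∫ τ in a..s, g τ) :
    ∫ τ in a..b, (f τ * G τ + F τ * g τ) = F b * G b - F a * G a := by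
  have hac : ∀ {c : ℝ} {u : ℝ → ℝ}, IntervalIntegrable u volume a b →
      AbsolutelyContinuousOnInterval (fun s => c + ∫ τ in a..s, u τ) a b := by
    intro c u hu
    exact ((LipschitzWith.const c).lipschitzOnWith.absolutelyContinuousOnInterval).fun_add
      (hu.absolutelyContinuousOnInterval_intervalIntegral Set.left_mem_uIcc)
  have h := (hac (c := F a) hf).integral_deriv_mul_eq_sub (hac (c := G a) hg)
  rw [← hF b (Set.right_mem_Icc.2 hab), ← hG b (Set.right_mem_Icc.2 hab),
    ← hF a (Set.left_mem_Icc.2 hab), ← hG a (Set.left_mem_Icc.2 hab)] at h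
  rw [← h]
  apply intervalIntegral.integral_congr_ae
  filter_upwards [hf.ae_hasDerivAt_integral, hg.ae_hasDerivAt_integral] with s h1 h2 hs
  have hs' : s ∈ Set.uIcc a b := Set.uIoc_subset_uIcc hs
  rw [((h1 hs' a Set.left_mem_uIcc).const_add (F a)).deriv,
    ((h2 hs' a Set.left_mem_uIcc).const_add (G a)).deriv]
  rw [Set.uIcc_of_le hab] at hs'
  rw [← hF s hs', ← hG s hs']

theorem intervalIntegrable_fun_sum {ι : Type*} (s : Finset ι) {f : ι → ℝ → ℝ} {a b : ℝ}
    (h : ∀ i ∈ s, IntervalIntegrable (f i) volume a b) :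
    IntervalIntegrable (fun τ => ∑ i ∈ s, f i τ) volume a b :=
  ⟨integrable_finsetSum s fun i hi => (h i hi).1, integrable_finsetSum s fun i hi => (h i hi).2⟩

theorem intervalIntegrable_apply {n : ℕ} {h : ℝ → Fin n → ℝ} {a b : ℝ}
    (hh : IntervalIntegrable h volume a b) (i : Fin n) :
    IntervalIntegrable (fun τ => h τ i) volume a b :=
  ⟨hh.1.eval i, hh.2.eval i⟩

theorem intervalIntegral_apply {n : ℕ} {h : ℝ → Fin n → ℝ} {a b : ℝ}
    (hh : IntervalIntegrable h volume a b) (i : Fin n) :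
    (∫ τ in a..b, h τ) i = ∫ τ in a..b, h τ i :=
  ((ContinuousLinearMap.proj (R := ℝ) (φ := fun _ : Fin n => ℝ) i).intervalIntegral_comp_comm
    hh).symm

theorem dotProduct_mulVec_eq_sum {n : ℕ} (P : Matrix (Fin n) (Fin n) ℝ) (x y : Fin n → ℝ) :
    x ⬝ᵥ (P *ᵥ y) = ∑ i, ∑ j, P i j * (x i * y j) := by
  simp only [dotProduct, Matrix.mulVec, Finset.mul_sum]
  exact Finset.sum_congr rfl fun i _ => Finset.sum_congr rfl fun j _ => by ring

theorem dotProduct_mulVec_comm {n : ℕ} {P : Matrix (Fin n) (Fin n) ℝ} (hP : P.IsSymm)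
    (x y : Fin n → ℝ) : x ⬝ᵥ (P *ᵥ y) = y ⬝ᵥ (P *ᵥ x) := by
  rw [Matrix.dotProduct_mulVec, ← Matrix.mulVec_transpose, hP.eq, dotProduct_comm]

theorem intervalIntegrable_dotProduct_mulVec {n : ℕ} (P : Matrix (Fin n) (Fin n) ℝ)
    {x y : ℝ → Fin n → ℝ} {a b : ℝ} (hx : ContinuousOn x (Set.uIcc a b))
    (hy : IntervalIntegrable y volume a b) :
    IntervalIntegrable (fun τ => x τ ⬝ᵥ (P *ᵥ y τ)) volume a b := by
  simp only [dotProduct_mulVec_eq_sum]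
  exact intervalIntegrable_fun_sum _ fun i _ => intervalIntegrable_fun_sum _ fun j _ =>
    ((intervalIntegrable_apply hy j).continuousOn_mul (continuousOn_pi.1 hx i)).const_mul _

/-- The fundamental theorem of calculus for a quadratic form along an absolutely continuous
curve. -/
theorem integral_dotProduct_mulVec {n : ℕ} {P : Matrix (Fin n) (Fin n) ℝ} (hP : P.IsSymm)
    {x h : ℝ → Fin n → ℝ} {a b : ℝ} (hab : a ≤ b) (hx : ContinuousOn x (Set.uIcc a b))
    (hh : IntervalIntegrable h volume a b)
    (hxh : ∀ s ∈ Set.Icc a b, x s = x a + ∫ τ in a..s, h τ) :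
    ∫ τ in a..b, 2 * (x τ ⬝ᵥ (P *ᵥ h τ)) = x b ⬝ᵥ (P *ᵥ x b) - x a ⬝ᵥ (P *ᵥ x a) := by
  have hi := fun i => intervalIntegrable_apply hh i
  have hc := fun i => continuousOn_pi.1 hx i
  have hxi : ∀ i, ∀ s ∈ Set.Icc a b, x s i = x a i + ∫ τ in a..s, h τ i := by
    intro i s hs
    have hsub : IntervalIntegrable h volume a s :=
      hh.mono_set (Set.uIcc_subset_uIcc_left (Set.Icc_subset_uIcc hs))
    rw [hxh s hs, Pi.add_apply, intervalIntegral_apply hsub]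
  -- Symmetry of `P` splits the factor 2 into the two halves of the product rule.
  have h1 : ∀ τ, 2 * (x τ ⬝ᵥ (P *ᵥ h τ)) =
      ∑ i, ∑ j, P i j * (h τ i * x τ j + x τ i * h τ j) := by
    intro τ
    rw [two_mul]
    nth_rewrite 1 [dotProduct_mulVec_comm hP]
    simp only [dotProduct_mulVec_eq_sum, ← Finset.sum_add_distrib, mul_add]
  have hint : ∀ i j, IntervalIntegrable (fun τ => P i j * (h τ i * x τ j + x τ i * h τ j))
      volume a b := fun i j =>
    (((hi i).mul_continuousOn (hc j)).add ((hi j).continuousOn_mul (hc i))).const_mul _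
  simp only [h1]
  rw [intervalIntegral.integral_finsetSum fun i _ =>
    intervalIntegrable_fun_sum _ fun j _ => hint i j]
  simp only [dotProduct_mulVec_eq_sum, ← Finset.sum_sub_distrib]
  refine Finset.sum_congr rfl fun i _ => ?_
  rw [intervalIntegral.integral_finsetSum fun j _ => hint i j]
  refine Finset.sum_congr rfl fun j _ => ?_
  rw [intervalIntegral.integral_const_mul,
    integral_mul_add_mul_eq_sub hab (hi i) (hi j) (hxi i) (hxi j), mul_sub]

/-! ### The operators `v` and `𝓑` -/

/-- Polarization of the identity on `x ⊗ x`: off the diagonal, `W_r⁻¹` recovers only the symmetrized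
tensor. -/
theorem wInv_mulVec_bvec_eq {n : ℕ} (x y : Fin n → ℝ) :
    wInv n *ᵥ bvec x y = (1 / 2 : ℝ) • (kron x y + kron y x) := by
  have h : bvec x y = (1 / 2 : ℝ) • (bvec (x + y) (x + y) - bvec x x - bvec y y) := by
    ext p
    simp only [bvec, Pi.add_apply, Pi.sub_apply, Pi.smul_apply, smul_eq_mul]
    ring
  rw [h, Matrix.mulVec_smul, Matrix.mulVec_sub, Matrix.mulVec_sub, wInv_mulVec_bvec,
    wInv_mulVec_bvec, wInv_mulVec_bvec]
  ext q
  simp only [kron, Pi.add_apply, Pi.sub_apply, Pi.smul_apply, smul_eq_mul]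
  ring

theorem vvec_eq_vecMul_wInv {n : ℕ} {P : Matrix (Fin n) (Fin n) ℝ} (hP : P.IsSymm) :
    vvec P = (fun q : Fin n × Fin n => P q.1 q.2) ᵥ* wInv n := by
  ext ⟨⟨a, b⟩, hab⟩
  have hs : P b a = P a b := hP.apply a b
  simp only [vvec, Matrix.vecMul, dotProduct, wInv, mul_ite, mul_one, mul_zero, Prod.swap_prod_mk]
  by_cases h : a = b
  · subst h
    simp
  · have h2 : ∀ q : Fin n × Fin n, (if q = (a, b) ∨ q = (b, a) then P q.1 q.2 else 0)
        = (if q = (a, b) then P q.1 q.2 else 0) + (if q = (b, a) then P q.1 q.2 else 0) := by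
      intro q
      by_cases h3 : q = (a, b)
      · subst h3
        simp [h]
      · simp [h3]
    simp only [h2, Finset.sum_add_distrib, Finset.sum_ite_eq', Finset.mem_univ, if_true, h,
      if_false, hs]
    ring

/-- The factor 2 in `v` compensates for listing each off-diagonal pair once. This duality converts
every regression term into a bilinear form in `P`. -/
theorem bvec_dotProduct_vvec {n : ℕ} {P : Matrix (Fin n) (Fin n) ℝ} (hP : P.IsSymm)
    (x y : Fin n → ℝ) : bvec x y ⬝ᵥ vvec P = x ⬝ᵥ (P *ᵥ y) := by
  have hk : ∀ z w : Fin n → ℝ,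
      (fun q : Fin n × Fin n => P q.1 q.2) ⬝ᵥ kron z w = z ⬝ᵥ (P *ᵥ w) := by
    intro z w
    rw [dotProduct_mulVec_eq_sum, dotProduct, Fintype.sum_prod_type]
    rfl
  rw [dotProduct_comm, vvec_eq_vecMul_wInv hP, ← Matrix.dotProduct_mulVec, wInv_mulVec_bvec_eq,
    dotProduct_smul, dotProduct_add, hk, hk, dotProduct_mulVec_comm hP y x, smul_eq_mul]
  ring

theorem vvec_neg {n : ℕ} (P : Matrix (Fin n) (Fin n) ℝ) : vvec (-P) = -vvec P := by
  ext p
  simp only [vvec, Matrix.neg_apply, Pi.neg_apply]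
  split_ifs <;> ring

theorem vvec_injOn_isSymm {n : ℕ} {P P' : Matrix (Fin n) (Fin n) ℝ} (hP : P.IsSymm)
    (hP' : P'.IsSymm) (h : vvec P = vvec P') : P = P' := by
  have key : ∀ a b, a ≤ b → P a b = P' a b := by
    intro a b hab
    have := congrFun h ⟨(a, b), hab⟩
    simp only [vvec] at this
    split_ifs at this
    · exact this
    · linarith
  ext a b
  rcases le_total a b with hab | hab
  · exact key a b hab
  · rw [← hP.apply, ← hP'.apply, key b a hab]

/-- On `𝓑(x, x)` the right inverse returns `x ⊗ x` itself, and `I ⊗ BK` acts on the second factor.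
-/
theorem wGain_mulVec_bvec {n m : ℕ} (B : Matrix (Fin n) (Fin m) ℝ) (K : Matrix (Fin m) (Fin n) ℝ)
    (x : Fin n → ℝ) : wGain B K *ᵥ bvec x x = bvec x ((B * K) *ᵥ x) := by
  have h : ((1 : Matrix (Fin n) (Fin n) ℝ) ⊗ₖ (B * K)) *ᵥ kron x x = kron x ((B * K) *ᵥ x) := by
    ext ⟨a, b⟩
    simp only [Matrix.mulVec, dotProduct, Matrix.kroneckerMap_apply, kron, Fintype.sum_prod_type,
      Matrix.one_apply, ite_mul, one_mul, zero_mul, Finset.mul_sum]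
    rw [Finset.sum_eq_single a]
    · exact Finset.sum_congr rfl fun j _ => by simp only [if_true]; ring
    · intro i _ hi
      simp [Ne.symm hi]
    · simp
  rw [wGain, ← Matrix.mulVec_mulVec, ← Matrix.mulVec_mulVec, wInv_mulVec_bvec, h,
    wMat_mulVec_kron]

/-! ### The regression -/

theorem intervalIntegrable_bvec {n : ℕ} {x y : ℝ → Fin n → ℝ} {a b : ℝ}
    (hx : ContinuousOn x (Set.uIcc a b)) (hy : IntervalIntegrable y volume a b) (p : Upper n) :
    IntervalIntegrable (fun τ => bvec (x τ) (y τ) p) volume a b := by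
  have h := fun i j =>
    (intervalIntegrable_apply hy j).continuousOn_mul (continuousOn_pi.1 hx i)
  exact ((h _ _).add (h _ _)).const_mul _

theorem intMat_mulVec {n l : ℕ} (t : Fin (l + 1) → ℝ) {x y : ℝ → Fin n → ℝ} (k : Fin l)
    (hx : ContinuousOn x (Set.uIcc (t k.castSucc) (t k.succ)))
    (hy : IntervalIntegrable y volume (t k.castSucc) (t k.succ)) (v : Upper n → ℝ) :
    (intMat t x y *ᵥ v) k = ∫ τ in (t k.castSucc)..(t k.succ), bvec (x τ) (y τ) ⬝ᵥ v := by
  simp only [dotProduct]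
  rw [intervalIntegral.integral_finsetSum fun p _ =>
    (intervalIntegrable_bvec hx hy p).mul_const _]
  simp only [intervalIntegral.integral_mul_const]
  rfl

theorem IsTrajectory.continuousOn {n m : ℕ} {f : (Fin n → ℝ) → Fin n → ℝ}
    {g : (Fin n → ℝ) → Matrix (Fin n) (Fin m) ℝ} {u : ℝ → Fin m → ℝ} {x : ℝ → Fin n → ℝ}
    {a b : ℝ} (hx : IsTrajectory f g u x a b) : ContinuousOn x (Set.Icc a b) := by
  rcases lt_or_ge b a with hab | hab
  · rw [Set.Icc_eq_empty (not_le.2 hab)]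
    exact continuousOn_empty _
  have h := intervalIntegral.continuousOn_primitive_interval'
    (hx.drift_integrable.add hx.input_integrable) Set.left_mem_uIcc
  rw [Set.uIcc_of_le hab] at h
  exact (continuousOn_const.add h).congr hx.integral_eq

theorem IsTrajectory.mono {n m : ℕ} {f : (Fin n → ℝ) → Fin n → ℝ}
    {g : (Fin n → ℝ) → Matrix (Fin n) (Fin m) ℝ} {u : ℝ → Fin m → ℝ} {x : ℝ → Fin n → ℝ}
    {a b c d : ℝ} (hx : IsTrajectory f g u x a b) (hac : a ≤ c) (hcd : c ≤ d) (hdb : d ≤ b) :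
    IsTrajectory f g u x c d := by
  have hsub : ∀ {c' d' : ℝ}, a ≤ c' → c' ≤ d' → d' ≤ b → Set.uIcc c' d' ⊆ Set.uIcc a b := by
    intro c' d' h1 h2 h3
    rw [Set.uIcc_of_le h2, Set.uIcc_of_le (h1.trans (h2.trans h3))]
    exact Set.Icc_subset_Icc h1 h3
  refine ⟨hx.drift_integrable.mono_set (hsub hac hcd hdb),
    hx.input_integrable.mono_set (hsub hac hcd hdb), fun s hs => ?_⟩
  have hi := hx.drift_integrable.add hx.input_integrable
  rw [hx.integral_eq s ⟨hac.trans hs.1, hs.2.trans hdb⟩,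
    hx.integral_eq c ⟨hac, hcd.trans hdb⟩, add_assoc,
    intervalIntegral.integral_add_adjacent_intervals
      (hi.mono_set (hsub le_rfl hac (hcd.trans hdb)))
      (hi.mono_set (hsub hac hs.1 (hs.2.trans hdb)))]

section Regression

variable {n m l : ℕ} {f : (Fin n → ℝ) → Fin n → ℝ} {g : (Fin n → ℝ) → Matrix (Fin n) (Fin m) ℝ}
  {A : Matrix (Fin n) (Fin n) ℝ} {B : Matrix (Fin n) (Fin m) ℝ} {t : Fin (l + 1) → ℝ}
  {x : ℝ → Fin n → ℝ} {u : ℝ → Fin m → ℝ}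

/-- Along a trajectory, the regression matrix evaluates the Lyapunov operator on the data. -/
theorem theta_mulVec_vvec (ht : StrictMono t)
    (hx : IsTrajectory f g u x (t 0) (t (Fin.last l))) (K : Matrix (Fin m) (Fin n) ℝ)
    {P : Matrix (Fin n) (Fin n) ℝ} (hP : P.IsSymm) :
    theta f g A B t x u K *ᵥ vvec P = intMat t x x *ᵥ vvec (lyap (A - B * K) P) := by
  ext k
  have hle : t k.castSucc ≤ t k.succ := (ht Fin.castSucc_lt_succ).le
  have hk := hx.mono (ht.monotone (Fin.zero_le _)) hle (ht.monotone (Fin.le_last _))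
  have hc : ContinuousOn x (Set.uIcc (t k.castSucc) (t k.succ)) := by
    rw [Set.uIcc_of_le hle]; exact hk.continuousOn
  have hxi : IntervalIntegrable x volume (t k.castSucc) (t k.succ) := hc.intervalIntegrable
  have hcM : ∀ M : Matrix (Fin n) (Fin n) ℝ,
      IntervalIntegrable (fun τ => M *ᵥ x τ) volume (t k.castSucc) (t k.succ) := fun M =>
    ((Continuous.matrix_mulVec continuous_const continuous_id).comp_continuousOn
      hc).intervalIntegrable
  have hw : IntervalIntegrable (fun τ => f (x τ) - A *ᵥ x τ) volume (t k.castSucc) (t k.succ) :=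
    hk.drift_integrable.sub (hcM A)
  -- The row pairs sum with difference, so it gives the increment of `xᵀPx` over the interval.
  have hdelta : (deltaMat t x x *ᵥ vvec P) k = ∫ τ in (t k.castSucc)..(t k.succ),
      2 * (x τ ⬝ᵥ (P *ᵥ (f (x τ) + g (x τ) *ᵥ u τ))) := by
    rw [integral_dotProduct_mulVec hP hle hc (hk.drift_integrable.add hk.input_integrable)
      hk.integral_eq]
    refine (bvec_dotProduct_vvec hP _ _).trans ?_
    simp only [Matrix.mulVec_sub, add_dotProduct, dotProduct_sub]
    rw [dotProduct_mulVec_comm hP (x (t k.castSucc)) (x (t k.succ))]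
    ring
  have hgain : (intMat t x x *ᵥ ((wGain B K)ᵀ *ᵥ vvec P)) k =
      ∫ τ in (t k.castSucc)..(t k.succ), x τ ⬝ᵥ (P *ᵥ ((B * K) *ᵥ x τ)) := by
    rw [intMat_mulVec t k hc hxi]
    congr 1
    ext τ
    rw [Matrix.dotProduct_mulVec, Matrix.vecMul_transpose, wGain_mulVec_bvec,
      bvec_dotProduct_vvec hP]
  have hL : (lyap (A - B * K) P).IsSymm := by
    rw [Matrix.IsSymm, ← lyap_transpose, hP.eq]
  rw [theta, Matrix.sub_mulVec, Matrix.smul_mulVec, Matrix.add_mulVec, Matrix.add_mulVec,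
    ← Matrix.mulVec_mulVec]
  simp only [Pi.sub_apply, Pi.smul_apply, Pi.add_apply, smul_eq_mul]
  rw [hdelta, hgain, intMat_mulVec t k hc hk.input_integrable, intMat_mulVec t k hc hw,
    intMat_mulVec t k hc hxi]
  simp only [bvec_dotProduct_vvec hP, bvec_dotProduct_vvec hL]
  have i0 := intervalIntegrable_dotProduct_mulVec P hc
    (hk.drift_integrable.add hk.input_integrable)
  have i1 := intervalIntegrable_dotProduct_mulVec P hc (hcM (B * K))
  have i2 := intervalIntegrable_dotProduct_mulVec P hc hk.input_integrable
  have i3 := intervalIntegrable_dotProduct_mulVec P hc hw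
  rw [← intervalIntegral.integral_add i1 i2, ← intervalIntegral.integral_add (i1.add i2) i3,
    ← intervalIntegral.integral_const_mul,
    ← intervalIntegral.integral_sub (i0.const_mul 2) (((i1.add i2).add i3).const_mul 2)]
  -- The integrands agree pointwise: `f + gu - BKx - gu - (f - Ax) = (A - BK)x`.
  congr 1
  ext τ
  rw [dotProduct_lyap, dotProduct_mulVec_comm hP ((A - B * K) *ᵥ x τ)]
  simp only [Matrix.sub_mulVec, Matrix.mulVec_add, Matrix.mulVec_sub, dotProduct_add,
    dotProduct_sub]
  ring

theorem mulVec_injective_of_rank {ι κ : Type*} [Fintype ι] [Fintype κ] {M : Matrix ι κ ℝ}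
    (hM : M.rank = Fintype.card κ) : Function.Injective M.mulVec := by
  classical
  rw [← Matrix.coe_mulVecLin, ← LinearMap.ker_eq_bot, ← Submodule.finrank_eq_zero (R := ℝ)]
  have h := M.mulVecLin.finrank_range_add_finrank_ker
  rw [Module.finrank_pi] at h
  change M.rank + _ = _ at h
  omega

/-- For a consistent system the minimal residual is 0, so the minimizers are the exact solutions. -/
theorem isLeastSquares_iff_of_exists {ι κ : Type*} [Fintype ι] [Fintype κ] {Θ : Matrix ι κ ℝ}
    {Ξ : ι → ℝ} (h : ∃ q, Θ *ᵥ q = Ξ) {p : κ → ℝ} : IsLeastSquares Θ Ξ p ↔ Θ *ᵥ p = Ξ := by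
  constructor
  · intro hp
    obtain ⟨q, hq⟩ := h
    have h1 := hp q
    simp only [hq, sub_self, ne_eq, OfNat.ofNat_ne_zero, not_false_eq_true, zero_pow,
      Finset.sum_const_zero] at h1
    have h2 := (Finset.sum_eq_zero_iff_of_nonneg fun k _ => sq_nonneg ((Θ *ᵥ p) k - Ξ k)).1
      (le_antisymm h1 (Finset.sum_nonneg fun k _ => sq_nonneg _))
    ext k
    have h3 := h2 k (Finset.mem_univ k)
    rwa [sq_eq_zero_iff, sub_eq_zero] at h3
  · intro hp q
    simp only [hp, sub_self, ne_eq, OfNat.ofNat_ne_zero, not_false_eq_true, zero_pow,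
      Finset.sum_const_zero]
    exact Finset.sum_nonneg fun k _ => sq_nonneg _

variable {Q : Matrix (Fin n) (Fin n) ℝ} {R : Matrix (Fin m) (Fin m) ℝ}
  {K₀ : Matrix (Fin m) (Fin n) ℝ}

/-- Both sides of the regression are the data matrix applied to `v` of a symmetric matrix; full rank
cancels the former, and injectivity of `v` on symmetric matrices the latter. -/
theorem theta_mulVec_vvec_eq_xi_iff (hQ : Q.PosSemidef) (hR : R.PosDef) (ht : StrictMono t)
    (hx : IsTrajectory f g u x (t 0) (t (Fin.last l)))
    (hrank : (intMat t x x).rank = n * (n + 1) / 2) (K : Matrix (Fin m) (Fin n) ℝ)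
    {P : Matrix (Fin n) (Fin n) ℝ} (hP : P.IsSymm) :
    theta f g A B t x u K *ᵥ vvec P = xi Q R t x K ↔
      lyap (A - B * K) P + (Kᵀ * R * K + Q) = 0 := by
  rw [← card_upper] at hrank
  have hL : (lyap (A - B * K) P).IsSymm := by
    rw [Matrix.IsSymm, ← lyap_transpose, hP.eq]
  have hC : (-(Kᵀ * R * K + Q)).IsSymm := (isSymm_of_posSemidef (posSemidef_cost hQ hR K)).neg
  rw [theta_mulVec_vvec ht hx K hP, xi, ← Matrix.mulVec_neg, ← vvec_neg, add_comm Q,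
    (mulVec_injective_of_rank hrank).eq_iff, add_eq_zero_iff_eq_neg]
  exact ⟨vvec_injOn_isSymm hL hC, congrArg vvec⟩

theorem isEIRL_iff (hQ : Q.PosSemidef) (hR : R.PosDef)
    (hdet : IsDetectable (CFC.sqrt Q) A) (hK₀ : IsHurwitz (A - B * K₀)) (ht : StrictMono t)
    (hx : IsTrajectory f g u x (t 0) (t (Fin.last l)))
    (hrank : (intMat t x x).rank = n * (n + 1) / 2)
    {P : ℕ → Matrix (Fin n) (Fin n) ℝ} {K : ℕ → Matrix (Fin m) (Fin n) ℝ} :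
    IsEIRL f g A B Q R t x u K₀ P K ↔
      P = kleinmanCost A B Q R K₀ ∧ K = kleinmanGain A B Q R K₀ := by
  -- The Hurwitz assumption provides a Lyapunov solution, hence consistency of the regression.
  have hLS : ∀ K : Matrix (Fin m) (Fin n) ℝ, IsHurwitz (A - B * K) →
      ∀ P : Matrix (Fin n) (Fin n) ℝ, P.IsSymm →
      (IsLeastSquares (theta f g A B t x u K) (xi Q R t x K) (vvec P) ↔
        lyap (A - B * K) P + (Kᵀ * R * K + Q) = 0) := by
    intro K hK P hP
    rw [← theta_mulVec_vvec_eq_xi_iff hQ hR ht hx hrank K hP]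
    exact isLeastSquares_iff_of_exists ⟨vvec (costMat A B Q R K),
      (theta_mulVec_vvec_eq_xi_iff hQ hR ht hx hrank K
        (isSymm_of_posSemidef (posSemidef_costMat hQ hR hK))).2 (lyap_costMat hK)⟩
  have hH := isHurwitz_kleinmanGain hQ hR hdet hK₀
  constructor
  · intro h
    exact eq_kleinman hQ hR hdet hK₀ h.init
      (fun i hi => (hLS _ hi _ (h.symm i)).1 (h.regression i)) h.update
  · rintro ⟨rfl, rfl⟩
    have hs : ∀ i, (kleinmanCost A B Q R K₀ i).IsSymm := fun i =>
      isSymm_of_posSemidef (posSemidef_costMat hQ hR (hH i))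
    exact ⟨rfl, hs, fun i => (hLS _ (hH i) _ (hs i)).2 (lyap_costMat (hH i)), fun i => rfl⟩

end Regression

end EIRL

end

theorem theorem2 {n m l : ℕ}
    -- the nonlinear affine system `x' = f(x) + g(x) u`
    (f : (Fin n → ℝ) → Fin n → ℝ) (g : (Fin n → ℝ) → Matrix (Fin n) (Fin m) ℝ)
    (Ω : Set (Fin n → ℝ)) (hΩ : IsCompact Ω) (hΩ0 : 0 ∈ interior Ω)
    (hf : ∃ C : NNReal, LipschitzOnWith C f Ω)
    (hg : ∀ i j, ∃ C : NNReal, LipschitzOnWith C (fun z => g z i j) Ω)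
    (hf0 : f 0 = 0)
    -- its linearization `(A, B)` at the origin, and the cost matrices
    (A : Matrix (Fin n) (Fin n) ℝ) (B : Matrix (Fin n) (Fin m) ℝ)
    (hA : HasFDerivAt f (LinearMap.toContinuousLinearMap (Matrix.toLin' A)) 0) (hB : B = g 0)
    (Q : Matrix (Fin n) (Fin n) ℝ) (R : Matrix (Fin m) (Fin m) ℝ)
    (hQ : Q.PosSemidef) (hR : R.PosDef)
    (hdet : EIRL.IsDetectable (CFC.sqrt Q) A)
    -- the initial stabilizing controller
    (K₀ : Matrix (Fin m) (Fin n) ℝ) (hK₀ : EIRL.IsHurwitz (A - B * K₀))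
    -- sample instants and data collected under `u = - K₀ x + d`
    (t : Fin (l + 1) → ℝ) (ht : StrictMono t)
    (x : ℝ → Fin n → ℝ) (u d : ℝ → Fin m → ℝ)
    (hu : ∀ τ ∈ Set.Icc (t 0) (t (Fin.last l)), u τ = -(K₀ *ᵥ x τ) + d τ)
    (hx : EIRL.IsTrajectory f g u x (t 0) (t (Fin.last l)))
    -- full column rank of the data matrix
    (hrank : (EIRL.intMat t x x).rank = n * (n + 1) / 2) :
    ∃ (P : ℕ → Matrix (Fin n) (Fin n) ℝ) (K : ℕ → Matrix (Fin m) (Fin n) ℝ),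
      -- Kleinman's algorithm produces exactly `P`, `K`, and so does the EIRL algorithm
      (∀ P' K', EIRL.IsKleinman A B Q R K₀ P' K' ↔ P' = P ∧ K' = K) ∧
      (∀ P' K', EIRL.IsEIRL f g A B Q R t x u K₀ P' K' ↔ P' = P ∧ K' = K) ∧
      -- stability and convergence
      (∀ i, EIRL.IsHurwitz (A - B * K i)) ∧
      ∃ Pstar : Matrix (Fin n) (Fin n) ℝ,
        (∀ P', EIRL.SolvesCARE A B Q R P' ↔ P' = Pstar) ∧
        (∀ i, Pstar ≤ P (i + 1) ∧ P (i + 1) ≤ P i) ∧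
        Tendsto K atTop (𝓝 (R⁻¹ * Bᵀ * Pstar)) ∧
        Tendsto P atTop (𝓝 Pstar) ∧
        -- positive definiteness in the observable case
        (EIRL.IsObservable (CFC.sqrt Q) A → Pstar.PosDef ∧ ∀ i, (P i).PosDef) := by
  obtain ⟨Pstar, hcare, hmono, hK, hP⟩ := EIRL.exists_care_tendsto_kleinman hQ hR hdet hK₀
  have hH := EIRL.isHurwitz_kleinmanGain hQ hR hdet hK₀
  refine ⟨EIRL.kleinmanCost A B Q R K₀, EIRL.kleinmanGain A B Q R K₀,
    fun _ _ => EIRL.isKleinman_iff hQ hR hdet hK₀,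
    fun _ _ => EIRL.isEIRL_iff hQ hR hdet hK₀ ht hx hrank, hH, Pstar, hcare,
    fun i => ⟨(hmono (i + 1)).1, (hmono i).2⟩, hK, hP, fun hobs => ⟨?_, fun i => ?_⟩⟩
  -- The Riccati solution satisfies the Lyapunov equation of its own gain, so the argument for the
  -- iterates applies to it too.
  · obtain ⟨h1, h2⟩ := (EIRL.solvesCARE_iff hR).1 ((hcare Pstar).2 rfl)
    exact EIRL.posDef_of_observable hQ hR hobs h1 h2
  · exact EIRL.posDef_of_observable hQ hR hobs (EIRL.posSemidef_costMat hQ hR (hH i))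
      (EIRL.lyap_costMat (hH i))
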